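/- Let $(\mathcal X,\mu)$ be a probability space, $f:\mathcal X\to\mathcal X$ a measurable map for which $\mu$ is invariant and ergodic, and $Y\subset\mathcal X$ a measurable set with $\mu(Y)>0$. Put $r_Y(x)=\inf\{n\ge 1: f^n(x)\in Y\}$, let $F_Y=f^{r_Y}$ be the first return map to $Y$ (defined $\mu$-almost everywhere on $Y$), and let $\mu_Y(\cdot)=\mu(\cdot\cap Y)/\mu(Y)$. Let $\varphi:\mathcal X\to\mathbb R$ be measurable, and let $(u_n)_n$ be real levels such that, for some $\tau>0$, $n\,\mu(\varphi>u_n)\to\tau$ as $n\to\infty$ (for example $\mu(\varphi>u_n)=\tau/n$ for all large $n$). Assume that, for all sufficiently large $n$, $\{\varphi>u_n\}\subset Y$ up to a $\mu$-null set. Let $\mathcal M_p([0,\infty))$ be the space of locally finite counting measures on $[0,\infty)$ with the vague topology (the topology generated by the maps $\nu\mapsto\int\psi\,d\nu$, $\psi:[0,\infty)\to\mathbb R$ continuous with compact support) and its Borel $\sigma$-algebra. The rare events point processes of the original and of the induced system are the random counting measures, on $(\mathcal X,\mu)$ and on $(Y,\mu_Y)$ respectively, $$N_n(A)=\#\{j\in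 v_nA\cap\mathbb N_0:\ \varphi(f^j(x))>u_n\},\qquad v_n=\frac1{\mu(\varphi>u_n)},$$ $$N_n^Y(A)=\#\{j\in v_n^YA\cap\mathbb N_0:\ \varphi(F_Y^j(x))>u_n\},\qquad v_n^Y=\frac1{\mu_Y(\varphi>u_n)},$$ defined for those $n$ for which $\mu(\varphi>u_n)>0$, respectively $\mu_Y(\varphi>u_n)>0$ (hence for all large $n$). Let $N$ be a point process on $[0,\infty)$, i.e. a random element of $\mathcal M_p([0,\infty))$, defined on some probability space with probability $P$. For a finite union $J$ of intervals $[a,b)$ with $a,b\in[0,\infty)$ and for $\eta>0$, let $J_\eta=\bigcup_{s\in J}B_\eta(s)$ be the open $\eta$-neighbourhood of $J$ in $[0,\infty)$. Assume that for every such $J$ the distribution of $N(J_\eta)$ depends continuously on $\eta$ for all small $\eta$: there is $\eta_0>0$ such that, for every $k\in\mathbb N_0$, the function $\eta\mapsto P(N(J_\eta)\ge k)$ is continuous on $(0,\eta_0)$. If $N_n^Y$ converges in distribution to $N$ under $\mu_Y$ as $n\to\infty$ (that is, the laws of $N_n^Y$ under $\mu_Y$ converge weakly on $\mathcal M_p([0,\infty))$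 to the law of $N$), then $N_n$ converges in distribution to $N$ under $\mu$ as $n\to\infty$. -/

import Mathlib

open MeasureTheory ProbabilityTheory Filter Topology Set
open scoped NNReal ENNReal

noncomputable section

/-- The space of counting measures on `[0, ∞)`: the locally finite Borel measures all of whose
values are natural numbers or `∞`. -/
structure CountingMeasure where
  toMeasure : Measure ℝ≥0
  locallyFinite : IsLocallyFiniteMeasure toMeasure
  integerValued : ∀ B : Set ℝ≥0, MeasurableSet B → ∃ k : ℕ∞, toMeasure B = (k : ℝ≥0∞)

namespace CountingMeasure

/-- The zero counting measure. -/
instance : Zero CountingMeasure where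
  zero :=
    { toMeasure := 0
      locallyFinite := inferInstance
      integerValued := fun _ _ => ⟨0, by simp⟩ }

/-- The vague topology: the coarsest topology that makes `ν ↦ ∫ ψ dν` continuous for every
continuous `ψ : [0, ∞) → ℝ` with compact support. -/
instance : TopologicalSpace CountingMeasure :=
  TopologicalSpace.induced
    (fun (ν : CountingMeasure) (ψ : CompactlySupportedContinuousMap ℝ≥0 ℝ) =>
      ∫ t, ψ t ∂ν.toMeasure) inferInstance

/-- The Borel sigma-algebra of the vague topology. -/
instance : MeasurableSpace CountingMeasure := borel CountingMeasure

instance : BorelSpace CountingMeasure := ⟨rfl⟩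

end CountingMeasure

/-- The measure `∑ δ_{j / v}`, the sum being over all times `j ∈ {0, 1, 2, …}` with `X j > u`. -/
def exceedanceMeasure (X : ℕ → ℝ) (u : ℝ) (v : ℝ≥0) : Measure ℝ≥0 :=
  Measure.sum fun j : {j : ℕ // u < X j} => Measure.dirac ((j : ℕ) / v : ℝ≥0)

/-- The mass of `A` is the number of exceedances of `u` at times in `v A`. -/
theorem exceedanceMeasure_apply (X : ℕ → ℝ) (u : ℝ) (v : ℝ≥0) {A : Set ℝ≥0}
    (hA : MeasurableSet A) :
    exceedanceMeasure X u v A = ({j : ℕ | u < X j ∧ (j / v : ℝ≥0) ∈ A}.encard : ℝ≥0∞) := by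
  rw [exceedanceMeasure, Measure.sum_apply _ hA]
  simp only [Measure.dirac_apply' _ hA]
  rw [← ENNReal.tsum_set_one]
  refine (tsum_subtype {j : ℕ | u < X j}
      (fun j : ℕ => A.indicator (1 : ℝ≥0 → ℝ≥0∞) ((j : ℝ≥0) / v))).trans ?_
  rw [tsum_subtype {j : ℕ | u < X j ∧ (j / v : ℝ≥0) ∈ A} (fun _ => (1 : ℝ≥0∞))]
  refine tsum_congr fun j => ?_
  by_cases h1 : u < X j <;> by_cases h2 : (j / v : ℝ≥0) ∈ A <;> simp [h1, h2]

theorem exceedanceMeasure_locallyFinite (X : ℕ → ℝ) (u : ℝ) {v : ℝ≥0} (hv : 0 < v) :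
    IsLocallyFiniteMeasure (exceedanceMeasure X u v) := by
  refine ⟨fun t => ⟨Iio (t + 1), Iio_mem_nhds (lt_add_one t), ?_⟩⟩
  rw [exceedanceMeasure_apply X u v measurableSet_Iio]
  have hfin : {j : ℕ | u < X j ∧ (j / v : ℝ≥0) ∈ Iio (t + 1)}.Finite := by
    obtain ⟨m, hm⟩ := exists_nat_gt ((t + 1) * v)
    refine (finite_lt_nat m).subset fun j hj => ?_
    have h := (div_lt_iff₀ hv).1 hj.2
    exact_mod_cast h.trans hm
  rw [← hfin.cast_ncard_eq]
  simp

/-- The counting measure `A ↦ #{j ∈ v A ∩ ℕ₀ : X j > u}` of the exceedances of the level `u` by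
the sequence `X` on the time scale `v > 0`. (The degenerate value for `v = 0` is `0`.) -/
def rareEventCount (X : ℕ → ℝ) (u : ℝ) (v : ℝ≥0) : CountingMeasure :=
  if hv : 0 < v then
    { toMeasure := exceedanceMeasure X u v
      locallyFinite := exceedanceMeasure_locallyFinite X u hv
      integerValued := fun _ hB => ⟨_, exceedanceMeasure_apply X u v hB⟩ }
  else 0

/-- The first return (or hitting) time `inf {n ≥ 1 : f^n x ∈ Y}`; it is `0` if there is no such
`n`. -/
def returnTime {S : Type*} (f : S → S) (Y : Set S) (x : S) : ℕ :=
  sInf {n : ℕ | 1 ≤ n ∧ f^[n] x ∈ Y}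

/-- The first return map `F_Y x = f^{r_Y(x)} x`. -/
def returnMap {S : Type*} (f : S → S) (Y : Set S) (x : S) : S :=
  f^[returnTime f Y x] x

/-- The rare event point process of the stationary process `φ, φ ∘ T, φ ∘ T², …` over `(S, m)` at
level `u`: exceedances of `u` are counted on the time scale `v = 1 / m(φ > u)`. -/
def REPP {S : Type*} [MeasurableSpace S] (T : S → S) (m : Measure S) (φ : S → ℝ) (u : ℝ) :
    S → CountingMeasure :=
  fun x => rareEventCount (fun j => φ (T^[j] x)) u (1 / (m {y | u < φ y}).toNNReal)

/-- The ring of finite unions of intervals `[a, b)` with `a, b ∈ [0, ∞)`. -/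
def IntervalRing : Set (Set ℝ≥0) :=
  {J | ∃ I : Finset (ℝ≥0 × ℝ≥0), J = ⋃ p ∈ I, Ico p.1 p.2}

/-- The open `η`-neighbourhood of `J` in `[0, ∞)`. -/
def etaNeighbourhood (J : Set ℝ≥0) (η : ℝ) : Set ℝ≥0 :=
  ⋃ s ∈ J, Metric.ball s η

/-- For every `J` in the ring, the distribution of the random variable `N(J_η)` (with values in
`{0, 1, 2, …}`) depends continuously on `η`, for all small `η > 0`. -/
def NeighbourhoodContinuity {Ω : Type*} [MeasurableSpace Ω] (P : Measure Ω)
    (N : Ω → CountingMeasure) : Prop :=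
  ∀ J ∈ IntervalRing, ∃ η₀ : ℝ, 0 < η₀ ∧ ∀ k : ℕ,
    ContinuousOn (fun η : ℝ => P {ω | (k : ℝ≥0∞) ≤ (N ω).toMeasure (etaNeighbourhood J η)})
      (Ioo 0 η₀)

end

/-! The vague topology is induced by countably many integrals, so weak convergence can be tested on
bounded functions `F` that are Lipschitz for the associated pseudometric
(`tendsto_probabilityMeasure_iff_of_isInducing`). Two processes whose test integrals are close in
probability then have close expectations of `F`. Two comparisons remain.

Original against induced process, both under `μ[|Y]` (`tendsto_lintegral_edist_REPP_returnMap`).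
Exceedances happen almost surely in `Y`, so an exceedance at time `j` is one at induced time `i`,
the number of visits to `Y` before `j`. With `θ = μ Y`, the two points are `j / v` and `i / (θ *
v)`. By the ergodic theorem, `i - j * θ` is small compared with `v`, uniformly for `j` of order `v`,
outside a set of small measure. So points move little; as the mean number of points in a bounded
window stays bounded, a uniformly continuous integrand gives nearly equal integrals.

`μ[|Y]` against `μ`, for the original process. Applying `f` moves each point by `1 / v` and may lose
the point at `0`, so `G n x = F (REPP f μ φ (u n) x)` is asymptotically `f`-invariant
(`tendsto_lintegral_edist_REPP_map`). Averaging the indicator of `Y` along orbits then shows that `G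
n` decorrelates from `Y` (`Ergodic.tendsto_setIntegral_sub_mul_integral`), so its means under both
measures have the same limit. -/

/-! ### Countable generation of the vague topology -/

/-- The function that is `1` on `[0, K]`, `0` on `[K + 1, ∞)` and affine in between. -/
noncomputable def plateau (K : ℕ) : CompactlySupportedContinuousMap ℝ≥0 ℝ where
  toFun t := max 0 (min 1 (K + 1 - (t : ℝ)))
  continuous_toFun := by fun_prop
  hasCompactSupport' := by
    refine HasCompactSupport.intro (isCompact_Icc (a := 0) (b := (K + 1 : ℝ≥0))) fun t ht => ?_
    have h : ((K + 1 : ℝ≥0) : ℝ) < t := by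
      by_contra! h
      exact ht ⟨zero_le, by exact_mod_cast h⟩
    push_cast at h
    exact max_eq_left ((min_le_right _ _).trans (by linarith))

theorem plateau_apply (K : ℕ) (t : ℝ≥0) : plateau K t = max 0 (min 1 (K + 1 - (t : ℝ))) := rfl

theorem plateau_nonneg (K : ℕ) (t : ℝ≥0) : 0 ≤ plateau K t := le_max_left _ _

theorem plateau_eq_one {K : ℕ} {t : ℝ≥0} (h : (t : ℝ) ≤ K) : plateau K t = 1 := by
  rw [plateau_apply, min_eq_left (by linarith), max_eq_right zero_le_one]

theorem plateau_eq_zero {K : ℕ} {t : ℝ≥0} (h : (K : ℝ) + 1 ≤ t) : plateau K t = 0 := by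
  rw [plateau_apply]
  exact max_eq_left ((min_le_right _ _).trans (by linarith))

/-- A countable family of test functions which determines the vague topology. -/
noncomputable def vagueTest : ℕ ⊕ ℕ × ℕ → CompactlySupportedContinuousMap ℝ≥0 ℝ
  | .inl K => plateau K
  | .inr (K, i) =>
    { toFun := fun t => plateau K t * TopologicalSpace.denseSeq C(ℝ≥0, ℝ) i t
      continuous_toFun := by fun_prop
      hasCompactSupport' := (plateau K).hasCompactSupport.mul_right }

theorem vagueTest_inr_apply (K i : ℕ) (t : ℝ≥0) :
    vagueTest (.inr (K, i)) t = plateau K t * TopologicalSpace.denseSeq C(ℝ≥0, ℝ) i t := rfl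

theorem exists_eq_zero_of_le (ψ : CompactlySupportedContinuousMap ℝ≥0 ℝ) :
    ∃ K : ℕ, 0 < K ∧ ∀ t : ℝ≥0, (K : ℝ) ≤ t → ψ t = 0 := by
  obtain ⟨b, hb⟩ := ψ.hasCompactSupport.isCompact.bddAbove
  obtain ⟨K, hK⟩ := exists_nat_gt b
  refine ⟨K, Nat.pos_of_ne_zero fun h => by simp [h] at hK, fun t ht => ?_⟩
  by_contra h
  have h1 : t ≤ b := hb (subset_tsupport _ h)
  have h2 : (K : ℝ≥0) ≤ t := by exact_mod_cast ht
  exact absurd (h2.trans h1) (not_le.2 hK)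

/-- Multiplying by the plateau leaves `ψ` unchanged, and density in the compact-open topology
approximates `ψ` on `[0, K + 1]`. The weight `plateau K` makes the error integrable against any
locally finite measure, and `K` must not depend on `ε`, so that a single plateau integral controls
all errors. -/
theorem exists_abs_sub_vagueTest_le (ψ : CompactlySupportedContinuousMap ℝ≥0 ℝ) :
    ∃ K : ℕ, ∀ ε > 0, ∃ i, ∀ t, |ψ t - vagueTest (.inr (K, i)) t| ≤ ε * plateau K t := by
  obtain ⟨K, -, hK⟩ := exists_eq_zero_of_le ψ
  refine ⟨K, fun ε hε => ?_⟩
  have hopen := ContinuousMap.tendsto_iff_forall_isCompact_tendstoUniformlyOn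
    (F := (id : C(ℝ≥0, ℝ) → C(ℝ≥0, ℝ))) (p := 𝓝 (ψ : C(ℝ≥0, ℝ))) (f := (ψ : C(ℝ≥0, ℝ)))
  have hnear := Metric.tendstoUniformlyOn_iff.1
    (hopen.1 tendsto_id (Icc 0 (K + 1 : ℝ≥0)) isCompact_Icc) ε hε
  obtain ⟨i, hi⟩ := (TopologicalSpace.denseRange_denseSeq C(ℝ≥0, ℝ)).exists_mem_open
    isOpen_interior ⟨_, mem_interior_iff_mem_nhds.2 hnear⟩
  refine ⟨i, fun t => ?_⟩
  have hmul : ψ t = plateau K t * ψ t := by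
    rcases le_total (t : ℝ) K with h | h
    · rw [plateau_eq_one h, one_mul]
    · rw [hK t h, mul_zero]
  rw [vagueTest_inr_apply, hmul, ← mul_sub, abs_mul, abs_of_nonneg (plateau_nonneg K t), mul_comm]
  rcases le_total (t : ℝ) (K + 1) with h | h
  · have h' := interior_subset hi t ⟨zero_le, by exact_mod_cast h⟩
    rw [Real.dist_eq] at h'
    exact mul_le_mul_of_nonneg_right h'.le (plateau_nonneg K t)
  · rw [plateau_eq_zero h]; simp

theorem integrable_countingMeasure (ν : CountingMeasure)
    (ψ : CompactlySupportedContinuousMap ℝ≥0 ℝ) : Integrable ψ ν.toMeasure :=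
  haveI := ν.locallyFinite
  ψ.continuous.integrable_of_hasCompactSupport ψ.hasCompactSupport

theorem continuous_integral_countingMeasure (ψ : CompactlySupportedContinuousMap ℝ≥0 ℝ) :
    Continuous fun ν : CountingMeasure => ∫ t, ψ t ∂ν.toMeasure :=
  continuous_pi_iff.1 (continuous_induced_dom (f := fun (ν : CountingMeasure)
    (ψ : CompactlySupportedContinuousMap ℝ≥0 ℝ) => ∫ t, ψ t ∂ν.toMeasure)) ψ

/-- The vague topology is induced by countably many integrals. -/
theorem isInducing_integral_vagueTest :
    IsInducing fun (ν : CountingMeasure) i => ∫ t, vagueTest i t ∂ν.toMeasure := by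
  refine ⟨le_antisymm ?_ ?_⟩
  · refine continuous_iff_le_induced.1 (continuous_pi fun i => ?_)
    exact continuous_integral_countingMeasure (vagueTest i)
  · let t : TopologicalSpace CountingMeasure := TopologicalSpace.induced
      (fun (ν : CountingMeasure) i => ∫ t, vagueTest i t ∂ν.toMeasure) inferInstance
    have hc : ∀ i, Continuous fun ν : CountingMeasure => ∫ t, vagueTest i t ∂ν.toMeasure :=
      continuous_pi_iff.1 (continuous_induced_dom
        (f := fun (ν : CountingMeasure) i => ∫ t, vagueTest i t ∂ν.toMeasure))
    refine continuous_iff_le_induced.1 (continuous_pi fun ψ => ?_)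
    obtain ⟨K, hK⟩ := exists_abs_sub_vagueTest_le ψ
    refine continuous_iff_continuousAt.2 fun ν₀ => ?_
    set c := ∫ t, plateau K t ∂ν₀.toMeasure with hcdef
    have hc0 : 0 ≤ c := integral_nonneg fun t => plateau_nonneg K t
    refine Metric.tendsto_nhds.2 fun ε hε => ?_
    -- Near `ν₀` the plateau integral is below `c + 1`, and at `ν₀` it is `c`: the two approximation
    -- errors add up to at most `ε / 2`.
    have hε' : 0 < ε / 2 / (2 * c + 1) := by positivity
    obtain ⟨i, hi⟩ := hK _ hε'
    have happ : ∀ ν : CountingMeasure,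
        |∫ t, ψ t ∂ν.toMeasure - ∫ t, vagueTest (.inr (K, i)) t ∂ν.toMeasure| ≤
          ε / 2 / (2 * c + 1) * ∫ t, plateau K t ∂ν.toMeasure := fun ν => by
      rw [← integral_sub (integrable_countingMeasure ν _) (integrable_countingMeasure ν _),
        ← integral_const_mul]
      exact (abs_integral_le_integral_abs).trans (integral_mono
        ((integrable_countingMeasure ν _).sub (integrable_countingMeasure ν _)).abs
        ((integrable_countingMeasure ν _).const_mul _) hi)
    filter_upwards [(hc (.inl K)).continuousAt.eventually_lt_const (lt_add_one c),
      Metric.tendsto_nhds.1 (hc (.inr (K, i))).continuousAt (ε / 2) (half_pos hε)] with ν h1 h2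
    rw [Real.dist_eq] at h2 ⊢
    have h3 := happ ν
    have h4 := happ ν₀
    have h5 : ε / 2 / (2 * c + 1) * (∫ t, plateau K t ∂ν.toMeasure) ≤
        ε / 2 / (2 * c + 1) * (c + 1) := mul_le_mul_of_nonneg_left h1.le hε'.le
    have h6 : ε / 2 / (2 * c + 1) * (c + 1) + ε / 2 / (2 * c + 1) * c = ε / 2 := by
      field_simp
      ring
    rw [← hcdef] at h4
    rw [abs_lt] at h2 ⊢
    rw [abs_le] at h3 h4
    constructor <;> linarith [h2.1, h2.2, h3.1, h3.2, h4.1, h4.2]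

/-! ### Weak convergence tested on Lipschitz functions -/

section Inducing

variable {E ι : Type*} [TopologicalSpace E] [MeasurableSpace E] [BorelSpace E] [Encodable ι]
  {g : ι → E → ℝ}

/-- If the topology is induced by countably many real functions, weak convergence can be tested on
functions which are Lipschitz for the associated metric. -/
theorem tendsto_probabilityMeasure_iff_of_isInducing (hg : IsInducing fun e i => g i e)
    {Ps : ℕ → ProbabilityMeasure E} {P : ProbabilityMeasure E} :
    Tendsto Ps atTop (𝓝 P) ↔ ∀ F : E → ℝ, Continuous F → (∃ C, ∀ x, |F x| ≤ C) →
      (∃ L : ℝ≥0, ∀ x y, edist (F x) (F y) ≤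
        L * ∑' i, min (2⁻¹ ^ Encodable.encode i) (edist (g i x) (g i y))) →
      Tendsto (fun n => ∫ e, F e ∂(Ps n : Measure E)) atTop (𝓝 (∫ e, F e ∂(P : Measure E))) := by
  constructor
  · rintro h F hF ⟨C, hC⟩ -
    exact (ProbabilityMeasure.tendsto_iff_forall_integral_tendsto.1 h)
      (BoundedContinuousFunction.ofNormedAddCommGroup F hF C hC)
  · intro h
    -- The given topology is replaced by the induced one, so that it agrees with the topology of the
    -- pulled-back product pseudometric.
    rename_i tE _ _ _
    obtain rfl := hg.eq_induced
    let iE : PseudoEMetricSpace E := PseudoEMetricSpace.induced (fun e i => g i e)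
      PiCountable.pseudoEMetricSpace
    refine tendsto_iff_forall_lipschitz_integral_tendsto.2 ?_
    rintro F ⟨C, hC⟩ ⟨L, hL⟩
    refine h F hL.continuous ?_ ⟨L, fun x y => hL x y⟩
    rcases isEmpty_or_nonempty E with hE | ⟨⟨x₀⟩⟩
    · exact ⟨0, fun x => (hE.false x).elim⟩
    · refine ⟨|F x₀| + C, fun x => ?_⟩
      have h1 := hC x x₀
      rw [Real.dist_eq] at h1
      have h2 := abs_sub_abs_le_abs_sub (F x) (F x₀)
      linarith

/-- Coordinatewise convergence in probability gives convergence in mean of the product distance: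
dominated convergence over the index set with counting measure, the weights `2⁻¹ ^ encode i` being
summable. -/
theorem tendsto_lintegral_tsum_min {S : Type*} [MeasurableSpace S] {m : Measure S}
    [IsProbabilityMeasure m] {X Y : ℕ → S → E} (hg : ∀ i, Continuous (g i))
    (hX : ∀ n, AEMeasurable (X n) m) (hY : ∀ n, AEMeasurable (Y n) m)
    (h : ∀ i, Tendsto (fun n => ∫⁻ x, min 1 (edist (g i (X n x)) (g i (Y n x))) ∂m) atTop (𝓝 0)) :
    Tendsto (fun n => ∫⁻ x, ∑' i, min (2⁻¹ ^ Encodable.encode i)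
      (edist (g i (X n x)) (g i (Y n x))) ∂m) atTop (𝓝 0) := by
  have hgX : ∀ i n, AEMeasurable (fun x => g i (X n x)) m := fun i n =>
    (hg i).measurable.comp_aemeasurable (hX n)
  have hgY : ∀ i n, AEMeasurable (fun x => g i (Y n x)) m := fun i n =>
    (hg i).measurable.comp_aemeasurable (hY n)
  have hpow : ∀ i : ι, (2⁻¹ : ℝ≥0∞) ^ Encodable.encode i ≤ 1 := fun i =>
    pow_le_one₀ zero_le (by simp)
  simp_rw [lintegral_tsum fun i => (aemeasurable_const (b := (2⁻¹ : ℝ≥0∞) ^ Encodable.encode i)).min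
    ((hgX i _).edist (hgY i _))]
  let mι : MeasurableSpace ι := ⊤
  have hdct := tendsto_lintegral_of_dominated_convergence (μ := (Measure.count : Measure ι))
    (F := fun n i => ∫⁻ x, min (2⁻¹ ^ Encodable.encode i) (edist (g i (X n x)) (g i (Y n x))) ∂m)
    (f := fun _ => 0) (fun i => 2⁻¹ ^ Encodable.encode i) (fun n => measurable_from_top)
    (fun n => ae_of_all _ fun i => (lintegral_mono fun x => min_le_left _ _).trans (by simp)) ?_
    (ae_of_all _ fun i => tendsto_of_tendsto_of_tendsto_of_le_of_le tendsto_const_nhds (h i)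
      (fun n => zero_le) fun n => lintegral_mono fun x => min_le_min_right _ (hpow i))
  · simpa only [lintegral_count, tsum_zero] using hdct
  · rw [lintegral_count]
    exact ne_top_of_le_ne_top (by simp) ENNReal.tsum_geometric_two_encode_le_two

theorem tendsto_integral_abs_sub_of_tendsto_lintegral {S : Type*} [MeasurableSpace S]
    {m : Measure S} [IsProbabilityMeasure m] {X Y : ℕ → S → E} (hg : ∀ i, Continuous (g i))
    (hX : ∀ n, AEMeasurable (X n) m) (hY : ∀ n, AEMeasurable (Y n) m)
    (h : ∀ i, Tendsto (fun n => ∫⁻ x, min 1 (edist (g i (X n x)) (g i (Y n x))) ∂m) atTop (𝓝 0))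
    {F : E → ℝ} {L : ℝ≥0} (hL : ∀ x y, edist (F x) (F y) ≤
        L * ∑' i, min (2⁻¹ ^ Encodable.encode i) (edist (g i x) (g i y))) (hF : Continuous F) :
    Tendsto (fun n => ∫ x, |F (X n x) - F (Y n x)| ∂m) atTop (𝓝 0) := by
  have h0 := ENNReal.Tendsto.const_mul (a := (L : ℝ≥0∞)) (tendsto_lintegral_tsum_min hg hX hY h)
    (Or.inr ENNReal.coe_ne_top)
  rw [mul_zero] at h0
  have h1 : Tendsto (fun n => ∫⁻ x, edist (F (X n x)) (F (Y n x)) ∂m) atTop (𝓝 0) := by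
    refine tendsto_of_tendsto_of_tendsto_of_le_of_le tendsto_const_nhds h0 (fun n => zero_le)
      fun n => ?_
    rw [← lintegral_const_mul' _ _ ENNReal.coe_ne_top]
    exact lintegral_mono fun x => hL _ _
  have h2 := (ENNReal.tendsto_toReal ENNReal.zero_ne_top).comp h1
  refine h2.congr fun n => ?_
  have hm : AEStronglyMeasurable (fun x => F (X n x) - F (Y n x)) m :=
    ((hF.measurable.comp_aemeasurable (hX n)).sub
      (hF.measurable.comp_aemeasurable (hY n))).aestronglyMeasurable
  simp only [Function.comp_apply, ← Real.norm_eq_abs]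
  rw [integral_norm_eq_lintegral_enorm hm]
  simp only [edist_eq_enorm_sub]

end Inducing

/-! ### Mean ergodic theorem and its consequences -/

section Ergodic

variable {S : Type*} [MeasurableSpace S] {μ : Measure S} {f : S → S}

theorem MeasureTheory.MeasurePreserving.integral_comp_of_aestronglyMeasurable
    (hf : MeasurePreserving f μ μ) {h : S → ℝ} (hh : AEStronglyMeasurable h μ) :
    ∫ x, h (f x) ∂μ = ∫ x, h x ∂μ := by
  conv_rhs => rw [← hf.map_eq]
  rw [integral_map hf.aemeasurable (by rwa [hf.map_eq])]

/-- This translates between the Koopman operator on `L²`, where von Neumann's theorem lives, and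
pointwise Birkhoff sums. -/
theorem birkhoffSum_compMeasurePreserving (hf : MeasurePreserving f μ μ) {h : S → ℝ}
    (hh : MemLp h 2 μ) (m : ℕ) : ∃ hm : MemLp (birkhoffSum f h m) 2 μ,
      birkhoffSum (Lp.compMeasurePreservingₗᵢ ℝ f hf) id m (hh.toLp h) = hm.toLp _ := by
  induction m with
  | zero => exact ⟨by simp [birkhoffSum_zero'], by simp [birkhoffSum_zero']⟩
  | succ m ih =>
    obtain ⟨hm, ih⟩ := ih
    have hs : birkhoffSum f h (m + 1) = birkhoffSum f h m + h ∘ f^[m] := by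
      funext x
      simp [birkhoffSum_succ]
    have hc := hh.comp_measurePreserving (hf.iterate m)
    refine ⟨hs ▸ hm.add hc, ?_⟩
    have hit : (Lp.compMeasurePreservingₗᵢ ℝ f hf)^[m] (hh.toLp h) = hc.toLp _ :=
      congr_fun (Lp.compMeasurePreserving_iterate hf m) (hh.toLp h)
    rw [birkhoffSum_succ, ih, id, hit, ← MemLp.toLp_add]
    exact MemLp.toLp_congr _ _ (by rw [hs])

variable [IsProbabilityMeasure μ]

/-- The mean ergodic theorem, in `L¹`. -/
theorem Ergodic.tendsto_integral_abs_birkhoffSum_div_sub (hf : Ergodic f μ) {h : S → ℝ}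
    (hh : MemLp h 2 μ) :
    Tendsto (fun m : ℕ => ∫ x, |birkhoffSum f h m x / m - ∫ y, h y ∂μ| ∂μ) atTop (𝓝 0) := by
  have hmp := hf.toMeasurePreserving
  set K := Lp.compMeasurePreservingₗᵢ (p := 2) ℝ (E := ℝ) f hmp with hK
  obtain ⟨g, hg, hlim⟩ : ∃ g : Lp ℝ 2 μ, K g = g ∧
      Tendsto (fun m => birkhoffAverage ℝ K id m (hh.toLp h)) atTop (𝓝 g) := by
    refine ⟨_, ?_, K.toContinuousLinearMap.tendsto_birkhoffAverage_orthogonalProjection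
      K.norm_toContinuousLinearMap_le (hh.toLp h)⟩
    exact (Submodule.orthogonalProjectionOnto (LinearMap.eqLocus
      (K.toContinuousLinearMap : Lp ℝ 2 μ →ₗ[ℝ] Lp ℝ 2 μ) _) (hh.toLp h)).2
  -- The limit is fixed by the Koopman operator, hence constant by ergodicity.
  obtain ⟨c, hc⟩ := hf.ae_eq_const_of_ae_eq_comp_ae (Lp.aestronglyMeasurable g)
    ((Lp.coeFn_compMeasurePreserving g hmp).symm.trans (by
      have : Lp.compMeasurePreserving f hmp g = g := hg
      rw [this]))
  have hint : ∀ m, Integrable (birkhoffSum f h m) μ := fun m =>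
    (birkhoffSum_compMeasurePreserving hmp hh m).choose.integrable one_le_two
  have hle : ∀ m : ℕ, ∫ x, |birkhoffSum f h m x / m - c| ∂μ ≤
      ‖birkhoffAverage ℝ K id m (hh.toLp h) - g‖ := fun m => by
    obtain ⟨hm, hm'⟩ := birkhoffSum_compMeasurePreserving hmp hh m
    have hae : (birkhoffAverage ℝ K id m (hh.toLp h) - g : Lp ℝ 2 μ) =ᵐ[μ]
        fun x => birkhoffSum f h m x / m - c := by
      rw [birkhoffAverage, hm']
      filter_upwards [Lp.coeFn_sub ((m : ℝ)⁻¹ • hm.toLp _) g,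
        Lp.coeFn_smul (m : ℝ)⁻¹ (hm.toLp _), hm.coeFn_toLp, hc] with x h1 h2 h3 h4
      simp only [h1, h2, h3, h4, Pi.sub_apply, Pi.smul_apply, Function.const_apply, smul_eq_mul]
      ring
    have hsm : AEStronglyMeasurable (fun x => birkhoffSum f h m x / m - c) μ :=
      (((hint m).div_const _).sub (integrable_const c)).aestronglyMeasurable
    rw [Lp.norm_def, eLpNorm_congr_ae hae]
    simp_rw [← Real.norm_eq_abs]
    rw [integral_norm_eq_lintegral_enorm hsm, ← eLpNorm_one_eq_lintegral_enorm]
    refine ENNReal.toReal_mono ?_ (eLpNorm_le_eLpNorm_of_exponent_le one_le_two hsm)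
    rw [← eLpNorm_congr_ae hae]
    exact Lp.eLpNorm_ne_top _
  have hlim0 : Tendsto (fun m : ℕ => ∫ x, |birkhoffSum f h m x / m - c| ∂μ) atTop (𝓝 0) :=
    squeeze_zero (fun m => integral_nonneg fun x => abs_nonneg _) hle
      (tendsto_iff_norm_sub_tendsto_zero.1 hlim)
  have hmean : ∀ m : ℕ, ∫ x, birkhoffSum f h m x ∂μ = m * ∫ x, h x ∂μ := fun m => by
    simp only [birkhoffSum]
    have hi : ∀ i, Integrable (fun x => h (f^[i] x)) μ := fun i =>
      (hh.comp_measurePreserving (hmp.iterate i)).integrable one_le_two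
    rw [integral_finsetSum _ fun i _ => hi i]
    have : ∀ i, ∫ x, h (f^[i] x) ∂μ = ∫ x, h x ∂μ := fun i =>
      (hmp.iterate i).integral_comp_of_aestronglyMeasurable hh.1
    simp [this]
  -- Each Birkhoff average with `m > 0` has mean `∫ h`, which forces the constant limit to be `∫ h`.
  have hcc : |(∫ x, h x ∂μ) - c| ≤ 0 := by
    refine ge_of_tendsto hlim0 ((eventually_gt_atTop 0).mono fun m hm => ?_)
    have hm' : (m : ℝ) ≠ 0 := by positivity
    calc |(∫ x, h x ∂μ) - c| = |∫ x, (birkhoffSum f h m x / m - c) ∂μ| := by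
          rw [integral_sub ((hint m).div_const _) (integrable_const c), integral_div, hmean]
          simp [hm']
      _ ≤ _ := abs_integral_le_integral_abs
  rw [← sub_eq_zero.1 (abs_nonpos_iff.1 hcc)] at hlim0
  exact hlim0

/-- Bounded functions which are asymptotically invariant under an ergodic map decorrelate from every
set. -/
theorem Ergodic.tendsto_setIntegral_sub_mul_integral (hf : Ergodic f μ) {Y : Set S}
    (hY : MeasurableSet Y) {G : ℕ → S → ℝ} (hG : ∀ n, AEStronglyMeasurable (G n) μ) {B : ℝ}
    (hB : ∀ n x, |G n x| ≤ B) (h : Tendsto (fun n => ∫ x, |G n (f x) - G n x| ∂μ) atTop (𝓝 0)) :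
    Tendsto (fun n => ∫ x in Y, G n x ∂μ - μ.real Y * ∫ x, G n x ∂μ) atTop (𝓝 0) := by
  have hmp := hf.toMeasurePreserving
  set I : S → ℝ := Y.indicator 1 with hI
  have hIm : Measurable I := measurable_one.indicator hY
  have hI1 : ∀ x, |I x| ≤ 1 := fun x => by by_cases hx : x ∈ Y <;> simp [hI, hx]
  have hI2 : MemLp I 2 μ := MemLp.of_bound hIm.aestronglyMeasurable 1 (ae_of_all _ hI1)
  have hIint : ∫ x, I x ∂μ = μ.real Y := integral_indicator_one hY
  have hGi : ∀ n, Integrable (G n) μ := fun n => Integrable.of_bound (hG n) B (ae_of_all _ (hB n))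
  have hGc : ∀ n i, Integrable (fun x => G n (f^[i] x)) μ := fun n i =>
    (hmp.iterate i).integrable_comp_of_integrable (hGi n)
  have hprod : ∀ {p q : S → ℝ}, Integrable p μ → Measurable q → (∀ x, |q x| ≤ 1) →
      Integrable (fun x => p x * q x) μ := fun hp hq hq1 =>
    hp.mul_bdd (c := 1) hq.aestronglyMeasurable (ae_of_all _ hq1)
  have hshift : ∀ n i, ∫ x, |G n (f^[i] x) - G n x| ∂μ ≤ i * ∫ x, |G n (f x) - G n x| ∂μ := by
    intro n i
    induction i with
    | zero => simp
    | succ i ih =>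
      have h1 : ∫ x, |G n (f^[i + 1] x) - G n (f^[i] x)| ∂μ = ∫ x, |G n (f x) - G n x| ∂μ := by
        have := (hmp.iterate i).integral_comp_of_aestronglyMeasurable
          (((hGc n 1).sub (hGi n)).abs.aestronglyMeasurable)
        simpa [Function.iterate_succ_apply'] using this
      have h2 : ∫ x, |G n (f^[i + 1] x) - G n x| ∂μ ≤
          ∫ x, |G n (f^[i + 1] x) - G n (f^[i] x)| ∂μ + ∫ x, |G n (f^[i] x) - G n x| ∂μ := by
        have ha : Integrable (fun x => |G n (f^[i + 1] x) - G n (f^[i] x)|) μ :=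
          ((hGc n _).sub (hGc n _)).abs
        have hb : Integrable (fun x => |G n (f^[i] x) - G n x|) μ := ((hGc n _).sub (hGi n)).abs
        rw [← integral_add ha hb]
        exact integral_mono ((hGc n _).sub (hGi n)).abs (ha.add hb) fun x => abs_sub_le _ _ _
      push_cast
      linarith
  -- By invariance `∫ G * I` equals the integral of `(G ∘ f^[i]) * (I ∘ f^[i])`; then `G ∘ f^[i]` is
  -- replaced by `G` at the cost `hshift`.
  have hcorr : ∀ n i, |∫ x, G n x * I x ∂μ - ∫ x, G n x * I (f^[i] x) ∂μ| ≤
      i * ∫ x, |G n (f x) - G n x| ∂μ := by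
    intro n i
    have hIi : Measurable fun x => I (f^[i] x) := hIm.comp (hmp.iterate i).measurable
    rw [← (hmp.iterate i).integral_comp_of_aestronglyMeasurable
      (hprod (hGi n) hIm hI1).aestronglyMeasurable,
      ← integral_sub (hprod (hGc n i) hIi fun x => hI1 _) (hprod (hGi n) hIi fun x => hI1 _)]
    refine (abs_integral_le_integral_abs.trans (integral_mono ?_ ?_ fun x => ?_)).trans (hshift n i)
    · exact ((hprod (hGc n i) hIi fun x => hI1 _).sub (hprod (hGi n) hIi fun x => hI1 _)).abs
    · exact ((hGc n _).sub (hGi n)).abs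
    · simp only [← sub_mul, abs_mul]
      exact mul_le_of_le_one_right (abs_nonneg _) (hI1 _)
  have hbound : ∀ m n : ℕ, 0 < m → |∫ x in Y, G n x ∂μ - μ.real Y * ∫ x, G n x ∂μ| ≤
      m * ∫ x, |G n (f x) - G n x| ∂μ +
        B * ∫ x, |birkhoffSum f I m x / m - ∫ y, I y ∂μ| ∂μ := by
    intro m n hm
    have hm' : (0 : ℝ) < m := by positivity
    set D := ∫ x, |G n (f x) - G n x| ∂μ with hD
    have hD0 : 0 ≤ D := integral_nonneg fun x => abs_nonneg _
    have hYI : ∫ x in Y, G n x ∂μ = ∫ x, G n x * I x ∂μ := by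
      rw [← integral_indicator hY]
      congr 1
      funext x
      by_cases hx : x ∈ Y <;> simp [hI, hx]
    have hIi : ∀ i, Measurable fun x => I (f^[i] x) := fun i =>
      hIm.comp (hmp.iterate i).measurable
    have hGIi : ∀ i, Integrable (fun x => G n x * I (f^[i] x)) μ := fun i =>
      hprod (hGi n) (hIi i) fun x => hI1 _
    have hsum : ∫ x, G n x * (birkhoffSum f I m x / m) ∂μ =
        (∑ i ∈ Finset.range m, ∫ x, G n x * I (f^[i] x) ∂μ) / m := by
      rw [← integral_finsetSum _ fun i _ => hGIi i, ← integral_div]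
      congr 1
      funext x
      rw [birkhoffSum, ← Finset.mul_sum]
      ring
    have hsi : Integrable (fun x => G n x * (birkhoffSum f I m x / m)) μ := by
      refine ((integrable_finsetSum (Finset.range m) fun i _ => hGIi i).div_const (m : ℝ)).congr
        (ae_of_all _ fun x => ?_)
      simp only [birkhoffSum, ← Finset.mul_sum]
      ring
    have h1 : |∫ x, G n x * I x ∂μ - ∫ x, G n x * (birkhoffSum f I m x / m) ∂μ| ≤ m * D := by
      have : ∫ x, G n x * I x ∂μ - ∫ x, G n x * (birkhoffSum f I m x / m) ∂μ =
          (∑ i ∈ Finset.range m,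
            (∫ x, G n x * I x ∂μ - ∫ x, G n x * I (f^[i] x) ∂μ)) / m := by
        rw [hsum, Finset.sum_sub_distrib]
        simp only [Finset.sum_const, Finset.card_range, nsmul_eq_mul]
        field_simp
      rw [this, abs_div, abs_of_pos hm', div_le_iff₀ hm']
      calc _ ≤ ∑ i ∈ Finset.range m,
            |∫ x, G n x * I x ∂μ - ∫ x, G n x * I (f^[i] x) ∂μ| := Finset.abs_sum_le_sum_abs _ _
        _ ≤ ∑ i ∈ Finset.range m, m * D := Finset.sum_le_sum fun i hi =>
            (hcorr n i).trans (mul_le_mul_of_nonneg_right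
              (by exact_mod_cast (Finset.mem_range.1 hi).le) hD0)
        _ = m * D * m := by simp; ring
    have hBi : Integrable (birkhoffSum f I m) μ :=
      (birkhoffSum_compMeasurePreserving hmp hI2 m).choose.integrable one_le_two
    have hdi : Integrable (fun x => birkhoffSum f I m x / m - ∫ y, I y ∂μ) μ :=
      (hBi.div_const _).sub (integrable_const _)
    have h2 : |∫ x, G n x * (birkhoffSum f I m x / m) ∂μ - (∫ y, I y ∂μ) * ∫ x, G n x ∂μ| ≤
        B * ∫ x, |birkhoffSum f I m x / m - ∫ y, I y ∂μ| ∂μ := by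
      rw [← integral_const_mul, ← integral_const_mul, ← integral_sub hsi ((hGi n).const_mul _)]
      refine abs_integral_le_integral_abs.trans (integral_mono
        (hsi.sub ((hGi n).const_mul _)).abs (hdi.abs.const_mul _) fun x => ?_)
      rw [mul_comm (∫ y, I y ∂μ), ← mul_sub, abs_mul]
      exact mul_le_mul_of_nonneg_right (hB n x) (abs_nonneg _)
    rw [hYI, ← hIint]
    exact (abs_sub_le _ _ _).trans (add_le_add h1 h2)
  have hB0 : Nonempty S → 0 ≤ B := fun ⟨x⟩ => (abs_nonneg _).trans (hB 0 x)
  have hB0 := hB0 (nonempty_of_isProbabilityMeasure μ)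
  -- The order of choices matters: `m` is fixed first to make the ergodic error small, and only then
  -- does `n` grow, with `m` times the invariance defect tending to `0`.
  refine Metric.tendsto_nhds.2 fun ε hε => ?_
  have hE := (hf.tendsto_integral_abs_birkhoffSum_div_sub hI2).const_mul B
  rw [mul_zero] at hE
  obtain ⟨m, hm, hm0⟩ := ((hE.eventually_lt_const (half_pos hε)).and
    (eventually_gt_atTop 0)).exists
  have hD := h.const_mul (m : ℝ)
  rw [mul_zero] at hD
  filter_upwards [hD.eventually_lt_const (half_pos hε)] with n hn
  rw [Real.dist_eq, sub_zero]
  linarith [hbound m n hm0]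

/-- Up to time `C v`, the number of visits to `Y` differs from its mean by at most `δ v`, with high
probability. -/
theorem Ergodic.tendsto_measure_exists_lt_abs_birkhoffSum_sub (hf : Ergodic f μ) {Y : Set S}
    (hY : MeasurableSet Y) (C : ℝ) {δ : ℝ} (hδ : 0 < δ) :
    Tendsto (fun v : ℝ => μ {x | ∃ j : ℕ, (j : ℝ) ≤ C * v ∧
      δ * v < |birkhoffSum f (Y.indicator 1) j x - j * μ.real Y|}) atTop (𝓝 0) := by
  set I : S → ℝ := Y.indicator 1 with hI
  set θ := μ.real Y with hθ
  have hIm : Measurable I := measurable_one.indicator hY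
  have hI2 : MemLp I 2 μ := MemLp.of_bound hIm.aestronglyMeasurable 1
    (ae_of_all _ fun x => by by_cases hx : x ∈ Y <;> simp [hI, hx])
  have hθ0 : 0 ≤ θ := measureReal_nonneg
  have hθ1 : θ ≤ 1 := measureReal_le_one
  set D : ℕ → ℝ := fun m => ∫ x, |birkhoffSum f I m x - m * θ| ∂μ with hD
  have hDi : ∀ m : ℕ, Integrable (fun x => |birkhoffSum f I m x - m * θ|) μ := fun m =>
    (((birkhoffSum_compMeasurePreserving hf.toMeasurePreserving hI2 m).choose.integrable
      one_le_two).sub (integrable_const _)).abs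
  have hD0 : (fun m => D m) =o[atTop] fun m : ℕ => (m : ℝ) := by
    rw [Asymptotics.isLittleO_iff_tendsto' ((eventually_gt_atTop 0).mono fun m hm h0 => by
      exact absurd h0 (by positivity))]
    refine (hf.tendsto_integral_abs_birkhoffSum_div_sub hI2).congr' ?_
    filter_upwards [eventually_gt_atTop 0] with m hm
    have hm' : (0 : ℝ) < m := by positivity
    rw [hD, ← integral_div]
    congr 1
    funext x
    rw [integral_indicator_one hY, ← hθ, ← abs_of_pos hm', ← abs_div, abs_of_pos hm', sub_div,
      mul_div_cancel_left₀ _ hm'.ne']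
  have hmono : ∀ x, Monotone fun j => birkhoffSum f I j x := fun x => by
    refine monotone_nat_of_le_succ fun j => ?_
    rw [birkhoffSum_succ]
    exact le_add_of_nonneg_right (indicator_nonneg (fun _ _ => zero_le_one) _)
  -- A grid of mesh between `δ * v / 4` and `δ * v / 2` has a bounded number of points up to time `C
  -- * v`. Markov's inequality handles each grid point, and monotonicity of the visit count handles
  -- the times in between.
  set l : ℝ → ℕ := fun v => ⌈δ * v / 4⌉₊ with hl
  have hl_top : Tendsto l atTop atTop := tendsto_nat_ceil_atTop.comp
    ((tendsto_id.const_mul_atTop hδ).atTop_div_const (by norm_num))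
  have hl_le : ∀ᶠ v in atTop, (l v : ℝ) ≤ δ * v / 2 := by
    filter_upwards [eventually_ge_atTop (4 / δ), eventually_ge_atTop 0] with v hv hv0
    have h1 := (Nat.ceil_lt_add_one (a := δ * v / 4) (by positivity)).le
    rw [div_le_iff₀ hδ] at hv
    change ((l v : ℕ) : ℝ) ≤ _ at h1
    linarith
  set Q := ⌈4 * C / δ⌉₊ with hQ
  have hgrid : ∀ k : ℕ, Tendsto (fun v : ℝ =>
      μ {x | δ * v / 2 ≤ |birkhoffSum f I (k * l v) x - (k * l v : ℕ) * θ|}) atTop (𝓝 0) := by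
    intro k
    have hratio : Tendsto (fun v => D (k * l v) / (δ * v / 2)) atTop (𝓝 0) := by
      rcases k.eq_zero_or_pos with rfl | hk
      · simp [hD]
      · refine Asymptotics.IsLittleO.tendsto_div_nhds_zero
          ((hD0.comp_tendsto (hl_top.const_mul_atTop' hk)).trans_isBigO ?_)
        refine Asymptotics.IsBigO.of_bound k ?_
        filter_upwards [hl_le] with v hv
        simp only [Function.comp_apply, Nat.cast_mul, norm_mul, Real.norm_natCast]
        exact mul_le_mul_of_nonneg_left (hv.trans (Real.le_norm_self _)) (Nat.cast_nonneg _)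
    have hup := ENNReal.tendsto_ofReal hratio
    rw [ENNReal.ofReal_zero] at hup
    refine tendsto_of_tendsto_of_tendsto_of_le_of_le' tendsto_const_nhds hup
      (Eventually.of_forall fun v => zero_le) ?_
    filter_upwards [eventually_gt_atTop 0] with v hv
    have hM := mul_meas_ge_le_integral_of_nonneg (ae_of_all _ fun x => abs_nonneg _)
      (hDi (k * l v)) (δ * v / 2)
    rw [← ofReal_measureReal]
    refine ENNReal.ofReal_le_ofReal ?_
    rw [le_div_iff₀ (by positivity), mul_comm]
    exact hM
  have hsum : Tendsto (fun v : ℝ => ∑ k ∈ Finset.range (Q + 2),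
      μ {x | δ * v / 2 ≤ |birkhoffSum f I (k * l v) x - (k * l v : ℕ) * θ|}) atTop (𝓝 0) := by
    simpa using tendsto_finsetSum (Finset.range (Q + 2)) fun k _ => hgrid k
  refine tendsto_of_tendsto_of_tendsto_of_le_of_le' tendsto_const_nhds hsum
    (Eventually.of_forall fun v => zero_le) ?_
  filter_upwards [hl_le, eventually_gt_atTop 0] with v hv hv0
  refine (measure_mono ?_).trans (measure_biUnion_finset_le _ _)
  rintro x ⟨j, hj, hjx⟩
  by_contra hx
  simp only [mem_iUnion, mem_ofPred_eq, exists_prop, not_exists, not_and, not_le,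
    Finset.mem_range] at hx
  have hlow : δ * v / 4 ≤ l v := Nat.le_ceil _
  have hl0 : 0 < l v := Nat.ceil_pos.2 (by positivity)
  have hkQ : j / l v ≤ Q := by
    have h1 : (j : ℝ) ≤ Q * l v := by
      have h2 : 4 * C / δ ≤ Q := Nat.le_ceil _
      rw [div_le_iff₀ hδ] at h2
      have h3 : (Q : ℝ) * (δ * v / 4) ≤ Q * l v :=
        mul_le_mul_of_nonneg_left hlow (Nat.cast_nonneg _)
      have h4 := mul_le_mul_of_nonneg_right h2 hv0.le
      linarith
    exact Nat.div_le_of_le_mul (by rw [mul_comm]; exact_mod_cast h1)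
  have hlo : j / l v * l v ≤ j := Nat.div_mul_le_self j (l v)
  have hhi : j ≤ (j / l v + 1) * l v := by
    rw [mul_comm]
    exact (Nat.lt_mul_div_succ j hl0).le
  -- At both grid neighbours of `j` the deviation is below `δ * v / 2`; interpolation costs at most
  -- one mesh more, another `δ * v / 2`.
  have b1 := hx (j / l v) (by omega)
  have b2 := hx (j / l v + 1) (by omega)
  have m1 := hmono x hlo
  have m2 := hmono x hhi
  have c1 : ((j / l v * l v : ℕ) : ℝ) ≤ j := by exact_mod_cast hlo
  have c2 : (j : ℝ) ≤ ((j / l v + 1) * l v : ℕ) := by exact_mod_cast hhi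
  have c3 : (((j / l v + 1) * l v : ℕ) : ℝ) = ((j / l v * l v : ℕ) : ℝ) + l v := by
    push_cast
    ring
  have d1 : (((j / l v + 1) * l v : ℕ) : ℝ) * θ ≤ j * θ + l v := by
    have := mul_le_mul_of_nonneg_right (c3.le.trans (add_le_add_left c1 (l v : ℝ))) hθ0
    have h5 : (l v : ℝ) * θ ≤ l v := mul_le_of_le_one_right (Nat.cast_nonneg _) hθ1
    linarith
  have d2 : (j : ℝ) * θ ≤ ((j / l v * l v : ℕ) : ℝ) * θ + l v := by
    have := mul_le_mul_of_nonneg_right (c2.trans c3.le) hθ0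
    have h5 : (l v : ℝ) * θ ≤ l v := mul_le_of_le_one_right (Nat.cast_nonneg _) hθ1
    linarith
  simp only at m1 m2
  rw [abs_lt] at b1 b2
  exact absurd hjx (not_lt.2 (abs_le.2 ⟨by linarith [b1.1], by linarith [b2.2]⟩))

end Ergodic

/-! ### Deterministic estimates for exceedance counts -/

section RareEventCount

variable {X : ℕ → ℝ} {u : ℝ} {v : ℝ≥0}

theorem integral_rareEventCount (hv : 0 < v) (ψ : CompactlySupportedContinuousMap ℝ≥0 ℝ) :
    ∫ t, ψ t ∂(rareEventCount X u v).toMeasure =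
      ∑' j : ℕ, {j : ℕ | u < X j}.indicator (fun j : ℕ => ψ (j / v)) j := by
  have hi := integrable_countingMeasure (rareEventCount X u v) ψ
  simp only [rareEventCount, dif_pos hv, exceedanceMeasure] at hi ⊢
  rw [← (hasSum_integral_measure hi).tsum_eq]
  simp only [integral_dirac]
  exact tsum_subtype {j : ℕ | u < X j} fun j : ℕ => ψ (j / v)

theorem apply_div_eq_zero {ψ : CompactlySupportedContinuousMap ℝ≥0 ℝ} {K : ℝ}
    (hψ : ∀ t : ℝ≥0, K ≤ t → ψ t = 0) (hv : 0 < v) {M : ℕ} (hM : K * v ≤ M) {j : ℕ} (hj : M ≤ j) :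
    ψ (j / v) = 0 := by
  refine hψ _ ?_
  have hv' : (0 : ℝ) < v := hv
  have hj' : (M : ℝ) ≤ j := by exact_mod_cast hj
  push_cast
  rw [le_div_iff₀ hv']
  exact hM.trans hj'

theorem integral_rareEventCount_eq_sum (hv : 0 < v) {ψ : CompactlySupportedContinuousMap ℝ≥0 ℝ}
    {K : ℝ} (hψ : ∀ t : ℝ≥0, K ≤ t → ψ t = 0) {M : ℕ} (hM : K * v ≤ M) :
    ∫ t, ψ t ∂(rareEventCount X u v).toMeasure =
      ∑ j ∈ Finset.range M, {j : ℕ | u < X j}.indicator (fun j : ℕ => ψ (j / v)) j := by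
  rw [integral_rareEventCount hv]
  refine tsum_eq_sum fun j hj => ?_
  rw [Finset.mem_range, not_lt] at hj
  exact indicator_apply_eq_zero.2 fun _ => apply_div_eq_zero hψ hv hM hj

/-- Moving the `j`-th point by at most `δ`, for all `j`, changes the integral by at most the number
of points times the `δ`-oscillation `ω` of the integrand. -/
theorem abs_integral_rareEventCount_sub_le_of_nth {p : ℕ → Prop} [DecidablePred p]
    (hp : {j | p j}.Infinite) {Z : ℕ → ℝ} (hZ : ∀ i, Z i = X (Nat.nth p i))
    (hu : ∀ j, u < X j → p j) (hv : 0 < v) {θ : ℝ≥0} (hθ : 0 < θ)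
    {ψ : CompactlySupportedContinuousMap ℝ≥0 ℝ} {K : ℝ} (hψ : ∀ t : ℝ≥0, K ≤ t → ψ t = 0)
    {δ ω : ℝ} (hδ : 0 ≤ δ) (hω : ∀ s t : ℝ≥0, dist s t ≤ δ → |ψ s - ψ t| ≤ ω) {M : ℕ}
    (hM : (K + δ) * v ≤ M)
    (hdev : ∀ j ≤ M, |(Nat.count p j : ℝ) - j * θ| ≤ δ * θ * v) :
    |∫ t, ψ t ∂(rareEventCount X u v).toMeasure -
        ∫ t, ψ t ∂(rareEventCount Z u (θ * v)).toMeasure| ≤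
      ∑ j ∈ Finset.range M, {j : ℕ | u < X j}.indicator (fun _ => ω) j := by
  have hv' : (0 : ℝ) < v := hv
  have hθ' : (0 : ℝ) < θ := hθ
  -- The sum over visit indices becomes a sum over original times: `Nat.count p` inverts `Nat.nth p`
  -- on visits, and every exceedance is a visit.
  have hZint : ∫ t, ψ t ∂(rareEventCount Z u (θ * v)).toMeasure =
      ∑' j : ℕ, {j : ℕ | u < X j}.indicator (fun j : ℕ => ψ (Nat.count p j / (θ * v))) j := by
    rw [integral_rareEventCount (mul_pos hθ hv),
      ← (Nat.nth_injective hp).tsum_eq (f := {j : ℕ | u < X j}.indicator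
        fun j : ℕ => ψ (Nat.count p j / (θ * v)))]
    · refine tsum_congr fun i => ?_
      simp only [indicator_apply, mem_ofPred_eq, hZ, Nat.count_nth_of_infinite hp]
    · intro j hj
      have hj' : j ∈ {j : ℕ | u < X j} := mem_of_indicator_ne_zero hj
      exact ⟨Nat.count p j, Nat.nth_count (hu j hj')⟩
  have hZsum : ∑' j : ℕ, {j : ℕ | u < X j}.indicator
      (fun j : ℕ => ψ (Nat.count p j / (θ * v))) j = ∑ j ∈ Finset.range M,
        {j : ℕ | u < X j}.indicator (fun j : ℕ => ψ (Nat.count p j / (θ * v))) j := by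
    refine tsum_eq_sum fun j hj => ?_
    rw [Finset.mem_range, not_lt] at hj
    -- The margin `δ` in `hM` is used here: at times from `M` on, the visit count is at least `M * θ
    -- - δ * θ * v`, hence at least `K * θ * v`.
    refine indicator_apply_eq_zero.2 fun _ => hψ _ ?_
    have h1 : (Nat.count p M : ℝ) ≤ Nat.count p j := by exact_mod_cast Nat.count_monotone p hj
    have h2 := (abs_le.1 (hdev M le_rfl)).1
    have h3 := mul_le_mul_of_nonneg_right hM hθ'.le
    push_cast
    rw [le_div_iff₀ (by positivity)]
    linarith
  have hKM : K * v ≤ M := by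
    have := mul_nonneg hδ hv'.le
    linarith
  rw [integral_rareEventCount_eq_sum hv hψ hKM, hZint, hZsum, ← Finset.sum_sub_distrib]
  refine (Finset.abs_sum_le_sum_abs _ _).trans (Finset.sum_le_sum fun j hj => ?_)
  by_cases hj' : u < X j
  · simp only [indicator_apply, mem_ofPred_eq, hj', if_true]
    refine hω _ _ ?_
    rw [NNReal.dist_eq]
    push_cast
    have h1 : (j : ℝ) / v - Nat.count p j / (θ * v) = -((Nat.count p j - j * θ) / (θ * v)) := by
      field_simp
      ring
    rw [h1, abs_neg, abs_div, abs_of_pos (mul_pos hθ' hv'), div_le_iff₀ (mul_pos hθ' hv')]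
    exact (hdev j (Finset.mem_range.1 hj).le).trans (by rw [mul_assoc])
  · simp [hj']

/-- The shift moves each point to the left by `1 / v`, except that a point at `0` disappears; it
accounts for the term with `|ψ 0|`. -/
theorem abs_integral_rareEventCount_shift_sub_le (hv : 0 < v)
    {ψ : CompactlySupportedContinuousMap ℝ≥0 ℝ} {K : ℝ} (hψ : ∀ t : ℝ≥0, K ≤ t → ψ t = 0)
    {δ ω : ℝ} (hω : ∀ s t : ℝ≥0, dist s t ≤ δ → |ψ s - ψ t| ≤ ω) (hδv : 1 / (v : ℝ) ≤ δ)
    {M : ℕ} (hM : K * v ≤ M) :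
    |∫ t, ψ t ∂(rareEventCount (fun j => X (j + 1)) u v).toMeasure -
        ∫ t, ψ t ∂(rareEventCount X u v).toMeasure| ≤
      {j : ℕ | u < X j}.indicator (fun _ => |ψ 0|) 0 +
        ∑ j ∈ Finset.range M, {j : ℕ | u < X j}.indicator (fun _ => ω) (j + 1) := by
  have hv' : (0 : ℝ) < v := hv
  rw [integral_rareEventCount_eq_sum hv hψ hM,
    integral_rareEventCount_eq_sum (M := M + 1) hv hψ (hM.trans (by push_cast; linarith)),
    Finset.sum_range_succ', ← sub_sub, ← Finset.sum_sub_distrib, add_comm]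
  refine (abs_sub _ _).trans (add_le_add ?_ ?_)
  · refine (Finset.abs_sum_le_sum_abs _ _).trans (Finset.sum_le_sum fun j hj => ?_)
    by_cases hj' : u < X (j + 1)
    · simp only [indicator_apply, mem_ofPred_eq, hj', if_true]
      refine hω _ _ ?_
      rw [NNReal.dist_eq]
      push_cast
      rw [← sub_div, sub_add_cancel_left, abs_div, abs_neg, abs_one, abs_of_pos hv']
      exact hδv
    · simp [hj']
  · by_cases hj' : u < X 0 <;> simp [hj']

theorem rareEventCount_congr {X' : ℕ → ℝ} {u' : ℝ} (h : ∀ j, u < X j ↔ u' < X' j) :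
    rareEventCount X u v = rareEventCount X' u' v := by
  have hm : exceedanceMeasure X u v = exceedanceMeasure X' u' v :=
    Measure.ext fun A hA => by simp_rw [exceedanceMeasure_apply _ _ _ hA, h]
  simp only [rareEventCount, hm]

/-- Measurability of the point processes is obtained by factoring through `ℕ → Bool`: each integral
depends on finitely many bits, so the counting map is continuous. -/
theorem continuous_rareEventCount_bool :
    Continuous fun b : ℕ → Bool => rareEventCount (fun j => if b j then 1 else 0) 0 v := by
  rcases eq_zero_or_pos v with rfl | hv
  · simp only [rareEventCount, lt_irrefl, dif_neg, not_false_eq_true]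
    exact continuous_const
  · refine continuous_induced_rng.2 (continuous_pi fun ψ => ?_)
    obtain ⟨K, -, hK⟩ := exists_eq_zero_of_le ψ
    obtain ⟨M, hM⟩ := exists_nat_ge ((K : ℝ) * v)
    simp only [Function.comp_def, integral_rareEventCount_eq_sum hv hK hM, indicator_apply,
      mem_ofPred_eq]
    refine continuous_finsetSum _ fun j _ => ?_
    exact (continuous_of_discreteTopology (f := fun c : Bool =>
      if (0 : ℝ) < (if c then 1 else 0) then ψ (j / v) else 0)).comp (continuous_apply j)

theorem measurable_rareEventCount {S : Type*} [MeasurableSpace S] {Z : S → ℕ → ℝ}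
    (hZ : ∀ j, Measurable fun x => Z x j) : Measurable fun x => rareEventCount (Z x) u v := by
  classical
  have h : (fun x => rareEventCount (Z x) u v) =
      (fun b : ℕ → Bool => rareEventCount (fun j => if b j then 1 else 0) 0 v) ∘
        fun x j => decide (u < Z x j) := by
    funext x
    refine rareEventCount_congr fun j => ?_
    by_cases hj : u < Z x j <;> simp [hj]
  rw [h]
  refine continuous_rareEventCount_bool.measurable.comp (measurable_pi_iff.2 fun j => ?_)
  refine measurable_to_bool ?_
  convert measurableSet_lt (measurable_const (a := u)) (hZ j) using 1
  ext x
  simp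

end RareEventCount

/-! ### Return map and successive visits -/

section ReturnMap

variable {S : Type*} {f : S → S} {Y : Set S} {x : S}

/-- The return time from the `i`-th visit is the gap to the next one, since no visit lies strictly
between. Infinitely many visits exclude the default value `0` of `returnTime`. -/
theorem iterate_returnMap_eq (hx : x ∈ Y) (hinf : {k | f^[k] x ∈ Y}.Infinite) (i : ℕ) :
    (returnMap f Y)^[i] x = f^[Nat.nth (fun k => f^[k] x ∈ Y) i] x := by
  set p : ℕ → Prop := fun k => f^[k] x ∈ Y with hp
  induction i with
  | zero => simp [Nat.nth_zero_of_zero (p := p) hx]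
  | succ i ih =>
    rw [Function.iterate_succ_apply', ih, returnMap, ← Function.iterate_add_apply]
    congr 1
    set a := Nat.nth p i with ha
    have hlt : a < Nat.nth p (i + 1) := Nat.nth_strictMono hinf i.lt_succ_self
    have hmem : Nat.nth p (i + 1) - a ∈ {n : ℕ | 1 ≤ n ∧ f^[n] (f^[a] x) ∈ Y} := by
      refine ⟨by omega, ?_⟩
      rw [← Function.iterate_add_apply, Nat.sub_add_cancel hlt.le]
      exact Nat.nth_mem_of_infinite hinf _
    have hle : returnTime f Y (f^[a] x) ≤ Nat.nth p (i + 1) - a := Nat.sInf_le hmem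
    obtain ⟨h1, h2⟩ : 1 ≤ returnTime f Y (f^[a] x) ∧
        f^[returnTime f Y (f^[a] x)] (f^[a] x) ∈ Y := Nat.sInf_mem ⟨_, hmem⟩
    rw [← Function.iterate_add_apply] at h2
    by_contra hne
    have h3 := Nat.le_nth_of_lt_nth_succ (p := p)
      (show returnTime f Y (f^[a] x) + a < Nat.nth p (i + 1) by omega) h2
    omega

open Classical in
theorem birkhoffSum_indicator_eq_count (j : ℕ) :
    birkhoffSum f (Y.indicator (1 : S → ℝ)) j x = Nat.count (fun k => f^[k] x ∈ Y) j := by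
  induction j with
  | zero => simp
  | succ j ih =>
    rw [birkhoffSum_succ, ih, Nat.count_succ]
    by_cases h : f^[j] x ∈ Y <;> simp [h]

end ReturnMap

theorem ENNReal.tendsto_zero_of_eventually_le_mul_ofReal {ι : Type*} {l : Filter ι}
    {a : ι → ℝ≥0∞} {c : ℝ≥0∞} (hc : c ≠ ∞)
    (h : ∀ η : ℝ, 0 < η → ∀ᶠ i in l, a i ≤ c * ENNReal.ofReal η) : Tendsto a l (𝓝 0) := by
  refine ENNReal.tendsto_nhds_zero.2 fun ε hε => ?_
  have h1 : Tendsto (fun η : ℝ => c * ENNReal.ofReal η) (𝓝[>] 0) (𝓝 0) := by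
    have h2 := ENNReal.Tendsto.const_mul (a := c)
      (ENNReal.tendsto_ofReal (tendsto_nhdsWithin_of_tendsto_nhds
        (s := Ioi (0 : ℝ)) (tendsto_id (x := 𝓝 (0 : ℝ))))) (Or.inr hc)
    simpa using h2
  obtain ⟨η, hη, hη0⟩ := ((ENNReal.tendsto_nhds_zero.1 h1 ε hε).and self_mem_nhdsWithin).exists
  exact (h η hη0).mono fun i hi => hi.trans hη

theorem exists_modulus (ψ : CompactlySupportedContinuousMap ℝ≥0 ℝ) {ω : ℝ} (hω : 0 < ω) :
    ∃ δ > 0, δ ≤ 1 ∧ ∀ s t : ℝ≥0, dist s t ≤ δ → |ψ s - ψ t| ≤ ω := by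
  have huc : UniformContinuous ψ :=
    ψ.hasCompactSupport.uniformContinuous_of_continuous ψ.continuous
  obtain ⟨δ, hδ, h⟩ := Metric.uniformContinuous_iff.1 huc ω hω
  refine ⟨min (δ / 2) 1, by positivity, min_le_right _ _, fun s t hst => ?_⟩
  rw [← Real.dist_eq]
  exact (h ((hst.trans (min_le_left _ _)).trans_lt (half_lt_self hδ))).le

/-! ### Closeness in probability of the rare event point processes -/

section Exceedance

variable {S : Type*} [MeasurableSpace S] {μ : Measure S} {f : S → S} {φ : S → ℝ} {u : ℕ → ℝ}

theorem lintegral_sum_indicator_exceedance (hf : MeasurePreserving f μ μ) (hφ : Measurable φ)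
    (w : ℝ) (c : ℝ) (k M : ℕ) :
    ∫⁻ x, ENNReal.ofReal (∑ j ∈ Finset.range M,
      {j : ℕ | w < φ (f^[j] x)}.indicator (fun _ => |c|) (j + k)) ∂μ =
      M * (ENNReal.ofReal |c| * μ {x | w < φ x}) := by
  have hE : MeasurableSet {x | w < φ x} := measurableSet_lt measurable_const hφ
  have h0 : ∀ x, ENNReal.ofReal (∑ j ∈ Finset.range M,
      {j : ℕ | w < φ (f^[j] x)}.indicator (fun _ => |c|) (j + k)) = ∑ j ∈ Finset.range M,
        {x | w < φ x}.indicator (fun _ => ENNReal.ofReal |c|) (f^[j + k] x) := fun x => by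
    rw [ENNReal.ofReal_sum_of_nonneg fun j _ => indicator_nonneg (fun _ _ => abs_nonneg _) _]
    refine Finset.sum_congr rfl fun j _ => ?_
    by_cases hj : w < φ (f^[j + k] x) <;> simp [hj]
  simp_rw [h0]
  have hm : Measurable ({x | w < φ x}.indicator fun _ => ENNReal.ofReal |c|) :=
    measurable_const.indicator hE
  have hmj : ∀ j, Measurable fun x =>
      {x | w < φ x}.indicator (fun _ => ENNReal.ofReal |c|) (f^[j + k] x) := fun j =>
    hm.comp (hf.iterate (j + k)).measurable
  rw [lintegral_finsetSum _ fun j _ => hmj j]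
  have h1 : ∀ j, ∫⁻ x, {x | w < φ x}.indicator (fun _ => ENNReal.ofReal |c|) (f^[j + k] x) ∂μ =
      ENNReal.ofReal |c| * μ {x | w < φ x} := fun j => by
    rw [(hf.iterate (j + k)).lintegral_comp hm, lintegral_indicator_const hE]
  simp [h1]

theorem REPP_apply_map (w : ℝ) (x : S) : REPP f μ φ w (f x) =
    rareEventCount (fun j => φ (f^[j + 1] x)) w (1 / (μ {y | w < φ y}).toNNReal) := rfl

theorem measurable_REPP (hf : Measurable f) (hφ : Measurable φ) (m : Measure S) (w : ℝ) :
    Measurable (REPP f m φ w) :=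
  measurable_rareEventCount fun j => hφ.comp (hf.iterate j)

theorem edist_min_le {a b c : ℝ} (h : |a - b| ≤ c) : min 1 (edist a b) ≤ ENNReal.ofReal c := by
  refine (min_le_right _ _).trans ?_
  rw [edist_dist, Real.dist_eq]
  exact ENNReal.ofReal_le_ofReal h

/-- Bookkeeping: at most `a * v` times, each an exceedance with probability `1 / v` and cost `ω`,
have total mean cost at most `a * ω`. -/
theorem nat_mul_ofReal_mul_le {m : ℝ≥0∞} {v : ℝ≥0} (hv : (v : ℝ≥0∞) * m = 1) {M : ℕ} {ω η a : ℝ}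
    (hω : 0 ≤ ω) (hM : (M : ℝ) ≤ a * v) (hη : a * ω ≤ η) :
    (M : ℝ≥0∞) * (ENNReal.ofReal |ω| * m) ≤ ENNReal.ofReal η := by
  have hv0 : (v : ℝ) ≠ 0 := fun h => by
    rw [NNReal.coe_eq_zero] at h
    simp [h] at hv
  have hv1 : (0 : ℝ) < v := lt_of_le_of_ne v.2 hv0.symm
  have ha : 0 ≤ a := by
    by_contra! h
    have h1 := mul_neg_of_neg_of_pos h hv1
    have h2 : (0 : ℝ) ≤ M := Nat.cast_nonneg M
    linarith
  rw [abs_of_nonneg hω]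
  calc (M : ℝ≥0∞) * (ENNReal.ofReal ω * m)
      = ENNReal.ofReal M * (ENNReal.ofReal ω * m) := by rw [ENNReal.ofReal_natCast]
    _ ≤ ENNReal.ofReal (a * v) * (ENNReal.ofReal ω * m) := by gcongr
    _ = ENNReal.ofReal (a * ω) * (v * m) := by
        rw [ENNReal.ofReal_mul ha, ENNReal.ofReal_mul ha, ENNReal.ofReal_coe_nnreal]
        ring
    _ ≤ ENNReal.ofReal η := by
        rw [hv, mul_one]
        exact ENNReal.ofReal_le_ofReal hη

/-- The integrals of the rare event point process are asymptotically invariant. -/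
theorem tendsto_lintegral_edist_REPP_map (hf : MeasurePreserving f μ μ) (hφ : Measurable φ)
    {v : ℕ → ℝ≥0} (hv : ∀ᶠ n in atTop, (v n : ℝ≥0∞) * μ {x | u n < φ x} = 1)
    (hvtop : Tendsto (fun n => (v n : ℝ)) atTop atTop)
    (ψ : CompactlySupportedContinuousMap ℝ≥0 ℝ) :
    Tendsto (fun n => ∫⁻ x, min 1 (edist (∫ t, ψ t ∂(REPP f μ φ (u n) (f x)).toMeasure)
      (∫ t, ψ t ∂(REPP f μ φ (u n) x).toMeasure)) ∂μ) atTop (𝓝 0) := by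
  refine ENNReal.tendsto_zero_of_eventually_le_mul_ofReal ENNReal.one_ne_top fun η hη => ?_
  obtain ⟨K, hK0, hK⟩ := exists_eq_zero_of_le ψ
  have hω : 0 < η / 2 / (K + 1) := by positivity
  set ω := η / 2 / (K + 1) with hωdef
  obtain ⟨δ, hδ, -, hδω⟩ := exists_modulus ψ hω
  -- The thresholds on `v n` make the shift `1 / v n` at most `δ`, absorb the rounding in `M`, and
  -- bound the mean cost `|ψ 0| / v n` of the lost point by `η / 2`.
  filter_upwards [hv, hvtop.eventually_ge_atTop (1 / δ), hvtop.eventually_ge_atTop 1,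
    hvtop.eventually_ge_atTop (|ψ 0| / (η / 2))] with n hn hn1 hn2 hn3
  have hv0 : 0 < v n := by
    rw [← NNReal.coe_pos]
    linarith
  have hv0' : (0 : ℝ) < v n := hv0
  have hvn : 1 / (μ {y | u n < φ y}).toNNReal = v n := by
    rw [ENNReal.eq_inv_of_mul_eq_one_left ((mul_comm _ _).trans hn)]
    simp
  set M := ⌈(K : ℝ) * v n⌉₊ with hM
  have hMle : (M : ℝ) ≤ (K + 1) * v n := by
    have := (Nat.ceil_lt_add_one (a := (K : ℝ) * v n) (by positivity)).le
    linarith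
  have hpt : ∀ x, min 1 (edist (∫ t, ψ t ∂(REPP f μ φ (u n) (f x)).toMeasure)
      (∫ t, ψ t ∂(REPP f μ φ (u n) x).toMeasure)) ≤
      ENNReal.ofReal (∑ j ∈ Finset.range 1,
        {j : ℕ | u n < φ (f^[j] x)}.indicator (fun _ => |ψ 0|) (j + 0)) +
      ENNReal.ofReal (∑ j ∈ Finset.range M,
        {j : ℕ | u n < φ (f^[j] x)}.indicator (fun _ => |ω|) (j + 1)) := fun x => by
    rw [← ENNReal.ofReal_add
      (Finset.sum_nonneg fun j _ => indicator_nonneg (fun _ _ => abs_nonneg _) _)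
      (Finset.sum_nonneg fun j _ => indicator_nonneg (fun _ _ => abs_nonneg _) _)]
    refine edist_min_le ?_
    rw [REPP_apply_map, REPP, hvn, abs_of_pos hω, Finset.sum_range_one]
    refine abs_integral_rareEventCount_shift_sub_le (X := fun j => φ (f^[j] x)) hv0 hK hδω ?_
      (Nat.le_ceil _)
    rw [div_le_iff₀ hv0']
    rw [div_le_iff₀ hδ] at hn1
    linarith
  have hmeas : Measurable fun x => ENNReal.ofReal (∑ j ∈ Finset.range 1,
      {j : ℕ | u n < φ (f^[j] x)}.indicator (fun _ => |ψ 0|) (j + 0)) := by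
    simp only [Finset.sum_range_one]
    refine ENNReal.measurable_ofReal.comp ?_
    exact (measurable_const (a := |ψ 0|)).indicator (measurableSet_lt measurable_const hφ)
  refine (lintegral_mono hpt).trans ?_
  rw [lintegral_add_left hmeas, lintegral_sum_indicator_exceedance hf hφ,
    lintegral_sum_indicator_exceedance hf hφ, one_mul, ← add_halves η,
    ENNReal.ofReal_add (half_pos hη).le (half_pos hη).le]
  refine add_le_add ?_ (nat_mul_ofReal_mul_le hn hω.le hMle (by rw [hωdef]; field_simp; rfl))
  have h1 := nat_mul_ofReal_mul_le (M := 1) (ω := |ψ 0|) (a := 1 / v n) (η := η / 2) hn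
    (abs_nonneg _) (by push_cast; field_simp; rfl) (by
      rw [div_le_iff₀ (by positivity)] at hn3
      rw [div_mul_eq_mul_div, one_mul, div_le_iff₀ hv0']
      linarith)
  rwa [abs_abs] at h1

variable [IsProbabilityMeasure μ]

/-- The integrals of the rare event point processes of the original and of the induced system are
close in probability. -/
theorem tendsto_lintegral_edist_REPP_returnMap (hf : Ergodic f μ) {Y : Set S}
    (hY : MeasurableSet Y) (hμY : μ Y ≠ 0) (hφ : Measurable φ)
    {v : ℕ → ℝ≥0} (hv : ∀ᶠ n in atTop, (v n : ℝ≥0∞) * μ {x | u n < φ x} = 1)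
    (hvtop : Tendsto (fun n => (v n : ℝ)) atTop atTop)
    (hUY : ∀ᶠ n in atTop, μ ({x | u n < φ x} \ Y) = 0)
    (ψ : CompactlySupportedContinuousMap ℝ≥0 ℝ) :
    Tendsto (fun n => ∫⁻ x, min 1 (edist (∫ t, ψ t ∂(REPP f μ φ (u n) x).toMeasure)
      (∫ t, ψ t ∂(REPP (returnMap f Y) (μ[|Y]) φ (u n) x).toMeasure)) ∂(μ[|Y]))
      atTop (𝓝 0) := by
  classical
  have hmp := hf.toMeasurePreserving
  refine ENNReal.tendsto_zero_of_eventually_le_mul_ofReal (c := (μ Y)⁻¹)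
    (ENNReal.inv_ne_top.2 hμY) fun η hη => ?_
  obtain ⟨K, hK0, hK⟩ := exists_eq_zero_of_le ψ
  have hω : 0 < η / 2 / (K + 2) := by positivity
  set ω := η / 2 / (K + 2) with hωdef
  obtain ⟨δ, hδ, hδ1, hδω⟩ := exists_modulus ψ hω
  set θ := (μ Y).toNNReal with hθ
  have hθμ : (θ : ℝ≥0∞) = μ Y := ENNReal.coe_toNNReal (measure_ne_top _ _)
  have hθ0 : 0 < θ := ENNReal.toNNReal_pos hμY (measure_ne_top _ _)
  have hθr : μ.real Y = θ := rfl
  have hθ0' : (0 : ℝ) < θ := hθ0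
  -- The horizon `K + 2` covers the window `K`, the margin `δ ≤ 1` and the rounding up; dividing the
  -- deviation `δ * θ * v` by the induced scale `θ * v` leaves a displacement of `δ`.
  have hdev := (hf.tendsto_measure_exists_lt_abs_birkhoffSum_sub hY (K + 2)
    (mul_pos hδ hθ0')).comp hvtop
  filter_upwards [hv, hvtop.eventually_ge_atTop 1, hUY, ENNReal.tendsto_nhds_zero.1 hdev
    (ENNReal.ofReal (η / 2)) (by simpa using hη)] with n hn hn2 hUn hdevn
  simp only [Function.comp_apply] at hdevn
  have hv0 : 0 < v n := by
    rw [← NNReal.coe_pos]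
    linarith
  have hv0' : (0 : ℝ) < v n := hv0
  have hμn : μ {x | u n < φ x} = (v n : ℝ≥0∞)⁻¹ :=
    ENNReal.eq_inv_of_mul_eq_one_left ((mul_comm _ _).trans hn)
  have hvn : 1 / (μ {y | u n < φ y}).toNNReal = v n := by
    rw [hμn]
    simp
  have hvYn : 1 / (μ[|Y] {y | u n < φ y}).toNNReal = θ * v n := by
    have hinter : μ (Y ∩ {x | u n < φ x}) = μ {x | u n < φ x} := by
      rw [inter_comm]
      have := measure_inter_add_sdiff (μ := μ) {x | u n < φ x} hY
      rwa [hUn, add_zero] at this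
    rw [cond_apply hY, hinter, hμn, ← hθμ]
    simp [mul_comm]
  set M := ⌈(K + δ) * (v n : ℝ)⌉₊ with hM
  have hMle : (M : ℝ) ≤ (K + 2) * v n := by
    have h1 := (Nat.ceil_lt_add_one (a := (K + δ) * (v n : ℝ)) (by positivity)).le
    have h2 := mul_le_mul_of_nonneg_right hδ1 hv0'.le
    linarith
  set A := {x | ∃ j : ℕ, (j : ℝ) ≤ (K + 2) * v n ∧
    δ * θ * v n < |birkhoffSum f (Y.indicator 1) j x - j * μ.real Y|} with hA
  -- Poincaré recurrence: almost every point of `Y` returns infinitely often.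
  have hrec : ∀ᵐ x ∂μ, x ∈ Y → ∃ᶠ k in atTop, f^[k] x ∈ Y :=
    hmp.conservative.ae_mem_imp_frequently_image_mem hY.nullMeasurableSet
  have hexc : ∀ᵐ x ∂μ, ∀ j, u n < φ (f^[j] x) → f^[j] x ∈ Y := by
    refine ae_all_iff.2 fun j => ?_
    have h1 : ∀ᵐ x ∂μ, u n < φ x → x ∈ Y := by
      rw [ae_iff]
      convert hUn using 2
      ext x
      simp
    exact (hmp.iterate j).quasiMeasurePreserving.ae h1
  have hpt : ∀ᵐ x ∂μ, x ∈ Y → min 1 (edist (∫ t, ψ t ∂(REPP f μ φ (u n) x).toMeasure)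
      (∫ t, ψ t ∂(REPP (returnMap f Y) (μ[|Y]) φ (u n) x).toMeasure)) ≤
      A.indicator (fun _ => 1) x + ENNReal.ofReal (∑ j ∈ Finset.range M,
        {j : ℕ | u n < φ (f^[j] x)}.indicator (fun _ => |ω|) (j + 0)) := by
    filter_upwards [hrec, hexc] with x h1 h2 hxY
    by_cases hxA : x ∈ A
    · rw [indicator_of_mem hxA]
      exact (min_le_left _ _).trans le_self_add
    · rw [indicator_of_notMem hxA, zero_add]
      have hinf : {k | f^[k] x ∈ Y}.Infinite := Nat.frequently_atTop_iff_infinite.1 (h1 hxY)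
      refine edist_min_le ?_
      rw [REPP, REPP, hvn, hvYn, abs_of_pos hω]
      refine abs_integral_rareEventCount_sub_le_of_nth (p := fun k => f^[k] x ∈ Y)
        (X := fun j => φ (f^[j] x)) hinf (fun i => ?_) h2 hv0 hθ0 hK hδ.le hδω (Nat.le_ceil _)
        fun j hj => ?_
      · rw [iterate_returnMap_eq hxY hinf]
      · simp only [hA, mem_ofPred_eq, not_exists, not_and, not_lt, birkhoffSum_indicator_eq_count,
          hθr] at hxA
        exact hxA j (le_trans (by exact_mod_cast hj) hMle)
  have hmeas : Measurable fun x => ENNReal.ofReal (∑ j ∈ Finset.range M,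
      {j : ℕ | u n < φ (f^[j] x)}.indicator (fun _ => |ω|) (j + 0)) := by
    refine ENNReal.measurable_ofReal.comp (Finset.measurable_sum _ fun j _ => ?_)
    exact (measurable_const (a := |ω|)).indicator
      (measurableSet_lt measurable_const (hφ.comp (hmp.iterate j).measurable))
  rw [ProbabilityTheory.cond, lintegral_smul_measure, smul_eq_mul]
  gcongr
  refine (lintegral_mono_ae ((ae_restrict_iff' hY).2 hpt)).trans
    ((lintegral_mono' Measure.restrict_le_self le_rfl).trans ?_)
  -- Splitting off the measurable summand and using an inequality for the indicator avoids any
  -- measurability of `A`.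
  rw [lintegral_add_right _ hmeas, lintegral_sum_indicator_exceedance hmp hφ, ← add_halves η,
    ENNReal.ofReal_add (half_pos hη).le (half_pos hη).le]
  refine add_le_add ((lintegral_indicator_const_le _ _).trans ?_)
    (nat_mul_ofReal_mul_le hn hω.le hMle (by rw [hωdef]; field_simp; rfl))
  rw [one_mul]
  exact hdevn

end Exceedance

/-! ### Transfer from the induced to the original system -/

theorem theorem3 {S : Type*} [MeasurableSpace S] (μ : Measure S) [IsProbabilityMeasure μ]
    (f : S → S) (hf : Ergodic f μ)
    (Y : Set S) (hY : MeasurableSet Y) (hμY : μ Y ≠ 0)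
    (φ : S → ℝ) (hφ : Measurable φ)
    (τ : ℝ) (hτ : 0 < τ) (u : ℕ → ℝ)
    (hu : Tendsto (fun n : ℕ => (n : ℝ) * μ.real {x | u n < φ x}) atTop (𝓝 τ))
    (hUY : ∀ᶠ n in atTop, μ ({x | u n < φ x} \ Y) = 0)
    {Ω : Type*} [MeasurableSpace Ω] (P : Measure Ω) [IsProbabilityMeasure P]
    (N : Ω → CountingMeasure) (hN : Measurable N) (hcont : NeighbourhoodContinuity P N) :
    haveI : IsProbabilityMeasure (μ[|Y]) := cond_isProbabilityMeasure hμY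
    TendstoInDistribution (fun n => REPP (returnMap f Y) (μ[|Y]) φ (u n)) atTop N
        (fun _ => μ[|Y]) P →
      TendstoInDistribution (fun n => REPP f μ φ (u n)) atTop N (fun _ => μ) P := by
  have : IsProbabilityMeasure (μ[|Y]) := cond_isProbabilityMeasure hμY
  intro hlim
  have hmp := hf.toMeasurePreserving
  have hmeas : ∀ n, Measurable (REPP f μ φ (u n)) := fun n =>
    measurable_REPP hmp.measurable hφ μ (u n)
  refine ⟨fun n => (hmeas n).aemeasurable, hN.aemeasurable, ?_⟩
  have hpos : ∀ᶠ n in atTop, μ {x | u n < φ x} ≠ 0 := by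
    filter_upwards [hu.eventually_const_lt hτ] with n hn h0
    simp [Measure.real, h0] at hn
  set v : ℕ → ℝ≥0 := fun n => 1 / (μ {x | u n < φ x}).toNNReal with hvdef
  have hv : ∀ᶠ n in atTop, (v n : ℝ≥0∞) * μ {x | u n < φ x} = 1 := by
    filter_upwards [hpos] with n hn
    have h1 : (μ {x | u n < φ x}).toNNReal ≠ 0 :=
      (ENNReal.toNNReal_pos hn (measure_ne_top _ _)).ne'
    rw [← ENNReal.coe_toNNReal (measure_ne_top μ {x | u n < φ x}), ← ENNReal.coe_mul]
    simp only [hvdef]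
    rw [one_div, inv_mul_cancel₀ h1, ENNReal.coe_one]
  have hvtop : Tendsto (fun n => (v n : ℝ)) atTop atTop := by
    have h1 : Tendsto (fun n : ℕ => (n : ℝ) / (n * μ.real {x | u n < φ x})) atTop atTop :=
      tendsto_natCast_atTop_atTop.atTop_mul_pos (inv_pos.2 hτ) (hu.inv₀ hτ.ne')
    refine h1.congr' ?_
    filter_upwards [eventually_gt_atTop 0] with n hn
    have hn' : (n : ℝ) ≠ 0 := by positivity
    rw [div_mul_cancel_left₀ hn', hvdef]
    simp [Measure.real, ENNReal.toReal]
  have hg : ∀ i, Continuous fun ν : CountingMeasure => ∫ t, vagueTest i t ∂ν.toMeasure :=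
    fun i => continuous_integral_countingMeasure _
  refine (tendsto_probabilityMeasure_iff_of_isInducing isInducing_integral_vagueTest).2 ?_
  rintro F hF ⟨C, hC⟩ ⟨L, hL⟩
  have hind := (tendsto_probabilityMeasure_iff_of_isInducing isInducing_integral_vagueTest).1
    hlim.tendsto F hF ⟨C, hC⟩ ⟨L, hL⟩
  simp only [ProbabilityMeasure.coe_mk] at hind ⊢
  have hFm : ∀ {m : Measure CountingMeasure}, AEStronglyMeasurable F m :=
    hF.measurable.aestronglyMeasurable
  -- Measurability of the induced process comes from the assumed convergence in distribution, not
  -- from the return map.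
  simp_rw [integral_map (hlim.forall_aemeasurable _) hFm] at hind
  simp_rw [integral_map (hmeas _).aemeasurable hFm]
  set G : ℕ → S → ℝ := fun n x => F (REPP f μ φ (u n) x) with hG
  have hGm : ∀ n, Measurable (G n) := fun n => hF.measurable.comp (hmeas n)
  have hGY : Tendsto (fun n => ∫ x, G n x ∂(μ[|Y])) atTop (𝓝 (∫ e, F e ∂(P.map N))) := by
    have h1 := tendsto_integral_abs_sub_of_tendsto_lintegral (m := μ[|Y]) hg
      (fun n => (hmeas n).aemeasurable) hlim.forall_aemeasurable
      (fun i => tendsto_lintegral_edist_REPP_returnMap hf hY hμY hφ hv hvtop hUY (vagueTest i))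
      hL hF
    have h2 : Tendsto (fun n => ∫ x, G n x ∂(μ[|Y]) -
        ∫ x, F (REPP (returnMap f Y) (μ[|Y]) φ (u n) x) ∂(μ[|Y])) atTop (𝓝 0) := by
      refine squeeze_zero_norm (fun n => ?_) h1
      rw [← integral_sub, Real.norm_eq_abs]
      · exact abs_integral_le_integral_abs
      · exact Integrable.of_bound (hGm n).aestronglyMeasurable C (ae_of_all _ fun x => hC _)
      · exact Integrable.of_bound (hF.measurable.comp_aemeasurable
          (hlim.forall_aemeasurable n)).aestronglyMeasurable C (ae_of_all _ fun x => hC _)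
    simpa using h2.add hind
  have hinv : Tendsto (fun n => ∫ x, |G n (f x) - G n x| ∂μ) atTop (𝓝 0) :=
    tendsto_integral_abs_sub_of_tendsto_lintegral hg
      (fun n => ((hmeas n).comp hmp.measurable).aemeasurable) (fun n => (hmeas n).aemeasurable)
      (fun i => tendsto_lintegral_edist_REPP_map hmp hφ hv hvtop (vagueTest i)) hL hF
  have hmix := hf.tendsto_setIntegral_sub_mul_integral hY
    (fun n => (hGm n).aestronglyMeasurable) (fun n x => hC _) hinv
  have hθ : μ.real Y ≠ 0 := (measureReal_ne_zero_iff (measure_ne_top _ _)).2 hμY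
  have h3 := hGY.sub (hmix.const_mul (μ.real Y)⁻¹)
  rw [mul_zero, sub_zero] at h3
  refine h3.congr fun n => ?_
  rw [ProbabilityTheory.cond, integral_smul_measure, ENNReal.toReal_inv, smul_eq_mul, ← Measure.real]
  field_simp
  ring
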